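/- Let $(M,g)$ be a smooth Lorentzian manifold of dimension at least $2$, with signature $(-,+,\dots,+)$ and Levi-Civita connection $\nabla^g$. Let $\nabla$ be a metric connection on $(M,g)$ (that is, $\nabla g=0$) whose torsion $T(X,Y)=\nabla_XY-\nabla_YX-[X,Y]$ is parallel, $\nabla T=0$, and twistor-free with vectorial component $\xi$, i.e. there are a smooth vector field $\xi$ and a $3$-form $S$ on $M$ (regarded, by means of $g$, as a $TM$-valued $2$-form, $g(S(X,Y),Z)=S(X,Y,Z)$) such that $$T(X,Y)=g(X,\xi)\,Y-g(Y,\xi)\,X+S(X,Y)\qquad\text{for all vector fields } X,Y .$$ Suppose that $\xi$ does not vanish identically. Then $(M,g)$ is not $\eta$-complete for any of $\eta=1,-1,0$; that is, $(M,g)$ is neither space-like ($\eta=1$), nor time-like ($\eta=-1$), nor light-like ($\eta=0$) geodesically complete. Here $(M,g)$ is called $\eta$-complete if for every $p\in M$ and every $v\in T_pM$, $v\ne 0$, such that $g(v,v)$ has sign $\eta$, the geodesic $\gamma$ of $\nabla^g$ with $\gamma(0)=p$, $\dot\gamma(0)=v$ is defined on all of $\mathbb R$. -/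

import Mathlib

open Bundle
open scoped Manifold ContDiff

noncomputable section

section
variable (E : Type*) [NormedAddCommGroup E] [NormedSpace ℝ E]
  (M : Type*) [TopologicalSpace M] [ChartedSpace E M] [IsManifold 𝓘(ℝ, E) ∞ M]

/-- A smooth pseudo-Riemannian metric on the (boundaryless) manifold `M` modelled on `E`: a smooth
family of symmetric nondegenerate bilinear forms on the tangent spaces. -/
structure PseudoRiemannianMetric where
  /-- The bilinear form `g_x` on `T_xM`. -/
  val (x : M) : TangentSpace 𝓘(ℝ, E) x →L[ℝ] TangentSpace 𝓘(ℝ, E) x →L[ℝ] ℝ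
  symm (x : M) (v w : TangentSpace 𝓘(ℝ, E) x) : val x v w = val x w v
  nondegenerate (x : M) (v : TangentSpace 𝓘(ℝ, E) x) (hv : ∀ w, val x v w = 0) : v = 0
  contMDiff : ContMDiff 𝓘(ℝ, E) (𝓘(ℝ, E).prod 𝓘(ℝ, E →L[ℝ] E →L[ℝ] ℝ)) ∞
    (fun x ↦ TotalSpace.mk' (E →L[ℝ] E →L[ℝ] ℝ)
      (E := fun x : M ↦ TangentSpace 𝓘(ℝ, E) x →L[ℝ] TangentSpace 𝓘(ℝ, E) x →L[ℝ] ℝ) x (val x))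
end

set_option linter.unusedSectionVars false

variable {E : Type*} [NormedAddCommGroup E] [NormedSpace ℝ E] [FiniteDimensional ℝ E]
  {M : Type*} [TopologicalSpace M] [ChartedSpace E M] [IsManifold 𝓘(ℝ, E) ∞ M]

namespace PseudoRiemannianMetric
variable (g : PseudoRiemannianMetric E M)

theorem mdiffAt {x : M} {X Y : Π x : M, TangentSpace 𝓘(ℝ, E) x}
    (hX : MDiffAt (T% X) x) (hY : MDiffAt (T% Y) x) :
    MDiffAt (fun y ↦ g.val y (X y) (Y y)) x := by
  have : MDifferentiableAt 𝓘(ℝ, E) (𝓘(ℝ, E).prod 𝓘(ℝ))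
      (fun m ↦ TotalSpace.mk' ℝ (E := Bundle.Trivial M ℝ) m (g.val m (X m) (Y m))) x :=
    MDifferentiableAt.clm_bundle_apply₂ (F₁ := E) (F₂ := E)
      (g.contMDiff.mdifferentiableAt (by simp)) hX hY
  simp only [mdifferentiableAt_totalSpace] at this
  exact this.2

/-- The right-hand side of the Koszul formula for `2 g(∇_X Y, Z)`. -/
def koszul (Y X Z : Π x : M, TangentSpace 𝓘(ℝ, E) x) (x : M) : ℝ :=
  mvfderiv 𝓘(ℝ, E) (fun y ↦ g.val y (Y y) (Z y)) x (X x)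
    + mvfderiv 𝓘(ℝ, E) (fun y ↦ g.val y (Z y) (X y)) x (Y x)
    - mvfderiv 𝓘(ℝ, E) (fun y ↦ g.val y (X y) (Y y)) x (Z x)
    + g.val x (VectorField.mlieBracket 𝓘(ℝ, E) X Y x) (Z x)
    - g.val x (VectorField.mlieBracket 𝓘(ℝ, E) Y Z x) (X x)
    + g.val x (VectorField.mlieBracket 𝓘(ℝ, E) Z X x) (Y x)

variable {g} {x : M} {X X' Y Y' Z Z' : Π x : M, TangentSpace 𝓘(ℝ, E) x}

theorem dsmul_left {f : M → ℝ} (hf : MDiffAt f x) (hX : MDiffAt (T% X) x) (hY : MDiffAt (T% Y) x) 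
    (v : TangentSpace 𝓘(ℝ, E) x) :
    mvfderiv 𝓘(ℝ, E) (fun y ↦ g.val y ((f • X) y) (Y y)) x v =
      f x * mvfderiv 𝓘(ℝ, E) (fun y ↦ g.val y (X y) (Y y)) x v
      + mvfderiv 𝓘(ℝ, E) f x v * g.val x (X x) (Y x) := by
  have : (fun y ↦ g.val y ((f • X) y) (Y y)) = f * (fun y ↦ g.val y (X y) (Y y)) := by
    ext y; simp
  rw [this, mvfderiv_mul hf (g.mdiffAt hX hY)]
  simp; ring

theorem dsmul_right {f : M → ℝ} (hf : MDiffAt f x) (hX : MDiffAt (T% X) x) (hY : MDiffAt (T% Y) x) 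
    (v : TangentSpace 𝓘(ℝ, E) x) :
    mvfderiv 𝓘(ℝ, E) (fun y ↦ g.val y (X y) ((f • Y) y)) x v =
      f x * mvfderiv 𝓘(ℝ, E) (fun y ↦ g.val y (X y) (Y y)) x v
      + mvfderiv 𝓘(ℝ, E) f x v * g.val x (X x) (Y x) := by
  have : (fun y ↦ g.val y (X y) ((f • Y) y)) = f * (fun y ↦ g.val y (X y) (Y y)) := by
    ext y; simp
  rw [this, mvfderiv_mul hf (g.mdiffAt hX hY)]
  simp; ring

theorem dadd_left (hX : MDiffAt (T% X) x) (hX' : MDiffAt (T% X') x) (hY : MDiffAt (T% Y) x) 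
    (v : TangentSpace 𝓘(ℝ, E) x) :
    mvfderiv 𝓘(ℝ, E) (fun y ↦ g.val y ((X + X') y) (Y y)) x v =
      mvfderiv 𝓘(ℝ, E) (fun y ↦ g.val y (X y) (Y y)) x v
      + mvfderiv 𝓘(ℝ, E) (fun y ↦ g.val y (X' y) (Y y)) x v := by
  have : (fun y ↦ g.val y ((X + X') y) (Y y)) =
    (fun y ↦ g.val y (X y) (Y y)) + (fun y ↦ g.val y (X' y) (Y y)) := by
    ext y; simp
  rw [this, mvfderiv_add (g.mdiffAt hX hY) (g.mdiffAt hX' hY)]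
  simp

theorem dadd_right (hX : MDiffAt (T% X) x) (hX' : MDiffAt (T% X') x) (hY : MDiffAt (T% Y) x) 
    (v : TangentSpace 𝓘(ℝ, E) x) :
    mvfderiv 𝓘(ℝ, E) (fun y ↦ g.val y (Y y) ((X + X') y)) x v =
      mvfderiv 𝓘(ℝ, E) (fun y ↦ g.val y (Y y) (X y)) x v
      + mvfderiv 𝓘(ℝ, E) (fun y ↦ g.val y (Y y) (X' y)) x v := by
  have : (fun y ↦ g.val y (Y y) ((X + X') y)) =
    (fun y ↦ g.val y (Y y) (X y)) + (fun y ↦ g.val y (Y y) (X' y)) := by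
    ext y; simp
  rw [this, mvfderiv_add (g.mdiffAt hY hX) (g.mdiffAt hY hX')]
  simp

theorem koszul_smul₁ {f : M → ℝ} (hf : MDiffAt f x) (hY : MDiffAt (T% Y) x)
    (hX : MDiffAt (T% X) x) (hZ : MDiffAt (T% Z) x) :
    g.koszul (f • Y) X Z x = f x * g.koszul Y X Z x
      + 2 * mvfderiv 𝓘(ℝ, E) f x (X x) * g.val x (Y x) (Z x) := by
  unfold koszul
  rw [dsmul_left hf hY hZ, dsmul_right hf hX hY, VectorField.mlieBracket_smul_right hf hY,
    VectorField.mlieBracket_smul_left hf hY]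
  simp [g.symm x (X x) (Y x)]
  ring

theorem koszul_smul₂ {f : M → ℝ} (hf : MDiffAt f x) (hY : MDiffAt (T% Y) x)
    (hX : MDiffAt (T% X) x) (hZ : MDiffAt (T% Z) x) :
    g.koszul Y (f • X) Z x = f x * g.koszul Y X Z x := by
  unfold koszul
  rw [dsmul_left hf hX hY, dsmul_right hf hZ hX, VectorField.mlieBracket_smul_right hf hX,
    VectorField.mlieBracket_smul_left hf hX]
  simp [g.symm x (Z x) (X x)]
  ring

theorem koszul_smul₃ {f : M → ℝ} (hf : MDiffAt f x) (hY : MDiffAt (T% Y) x)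
    (hX : MDiffAt (T% X) x) (hZ : MDiffAt (T% Z) x) :
    g.koszul Y X (f • Z) x = f x * g.koszul Y X Z x := by
  unfold koszul
  rw [dsmul_left hf hZ hX, dsmul_right hf hY hZ, VectorField.mlieBracket_smul_right hf hZ,
    VectorField.mlieBracket_smul_left hf hZ]
  simp [g.symm x (Z x) (Y x)]
  ring

theorem koszul_add₁ (hY : MDiffAt (T% Y) x) (hY' : MDiffAt (T% Y') x)
    (hX : MDiffAt (T% X) x) (hZ : MDiffAt (T% Z) x) :
    g.koszul (Y + Y') X Z x = g.koszul Y X Z x + g.koszul Y' X Z x := by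
  unfold koszul
  rw [dadd_left hY hY' hZ, dadd_right hY hY' hX, VectorField.mlieBracket_add_right hY hY',
    VectorField.mlieBracket_add_left hY hY']
  simp
  ring

theorem koszul_add₂ (hY : MDiffAt (T% Y) x) 
    (hX : MDiffAt (T% X) x) (hX' : MDiffAt (T% X') x) (hZ : MDiffAt (T% Z) x) :
    g.koszul Y (X + X') Z x = g.koszul Y X Z x + g.koszul Y X' Z x := by
  unfold koszul
  rw [dadd_left hX hX' hY, dadd_right hX hX' hZ, VectorField.mlieBracket_add_right hX hX',
    VectorField.mlieBracket_add_left hX hX']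
  simp
  ring

theorem koszul_add₃ (hY : MDiffAt (T% Y) x) 
    (hX : MDiffAt (T% X) x) (hZ : MDiffAt (T% Z) x) (hZ' : MDiffAt (T% Z') x) :
    g.koszul Y X (Z + Z') x = g.koszul Y X Z x + g.koszul Y X Z' x := by
  unfold koszul
  rw [dadd_left hZ hZ' hX, dadd_right hZ hZ' hY, VectorField.mlieBracket_add_right hZ hZ',
    VectorField.mlieBracket_add_left hZ hZ']
  simp
  ring

variable (g)


theorem exists_flat_eq (x : M) (φ : TangentSpace 𝓘(ℝ, E) x →L[ℝ] ℝ) : ∃ v, g.val x v = φ := by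
  have key : ∀ B : E →L[ℝ] E →L[ℝ] ℝ, (∀ v, (∀ w, B v w = 0) → v = 0) →
      ∀ φ : E →L[ℝ] ℝ, ∃ v, B v = φ := by
    intro B hB φ
    have hinj : Function.Injective
        ((LinearMap.toContinuousLinearMap (𝕜 := ℝ) (E := E) (F' := ℝ)).symm.toLinearMap ∘ₗ
          B.toLinearMap) := by
      rw [← LinearMap.ker_eq_bot, LinearMap.ker_eq_bot']
      intro v hv
      exact hB v fun w ↦ by simpa using congr($hv w)
    have hfr : Module.finrank ℝ E = Module.finrank ℝ (E →ₗ[ℝ] ℝ) := by simp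
    obtain ⟨v, hv⟩ := (LinearMap.injective_iff_surjective_of_finrank_eq_finrank hfr).1 hinj
      φ.toLinearMap
    exact ⟨v, by ext w; simpa using congr($hv w)⟩
  exact key (g.val x) (g.nondegenerate x) φ

theorem ext_of_val {x : M} {v v' : TangentSpace 𝓘(ℝ, E) x} (h : ∀ w, g.val x v w = g.val x v' w) :
    v = v' := by
  rw [← sub_eq_zero]
  exact g.nondegenerate x _ fun w ↦ by simp [h]

theorem exists_koszul (Y : Π x : M, TangentSpace 𝓘(ℝ, E) x) (x : M) :
    ∃ L : TangentSpace 𝓘(ℝ, E) x →L[ℝ] TangentSpace 𝓘(ℝ, E) x, MDiffAt (T% Y) x →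
      ∀ X Z : Π x : M, TangentSpace 𝓘(ℝ, E) x, MDiffAt (T% X) x → MDiffAt (T% Z) x →
        2 * g.val x (L (X x)) (Z x) = g.koszul Y X Z x := by
  by_cases hY : MDiffAt (T% Y) x
  swap
  · exact ⟨0, fun h ↦ absurd h hY⟩
  have h₁ : ∀ Z : Π x : M, TangentSpace 𝓘(ℝ, E) x, MDiffAt (T% Z) x →
      TensorialAt 𝓘(ℝ, E) E (fun X ↦ g.koszul Y X Z x) x := fun Z hZ ↦
    ⟨fun hf hX ↦ koszul_smul₂ hf hY hX hZ, fun hX hX' ↦ koszul_add₂ hY hX hX' hZ⟩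
  have h₂ : ∀ X : Π x : M, TangentSpace 𝓘(ℝ, E) x, MDiffAt (T% X) x →
      TensorialAt 𝓘(ℝ, E) E (fun Z ↦ g.koszul Y X Z x) x := fun X hX ↦
    ⟨fun hf hZ ↦ koszul_smul₃ hf hY hX hZ, fun hZ hZ' ↦ koszul_add₃ hY hX hZ hZ'⟩
  let B := TensorialAt.mkHom₂ (fun X Z ↦ g.koszul Y X Z x) x h₁ h₂
  choose r hr using g.exists_flat_eq x
  have : FiniteDimensional ℝ (TangentSpace 𝓘(ℝ, E) x) := inferInstanceAs (FiniteDimensional ℝ E)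
  have : T2Space (TangentSpace 𝓘(ℝ, E) x) := inferInstanceAs (T2Space E)
  let L : TangentSpace 𝓘(ℝ, E) x →ₗ[ℝ] TangentSpace 𝓘(ℝ, E) x :=
    { toFun := fun v ↦ (1 / 2 : ℝ) • r (B v)
      map_add' := fun v w ↦ g.ext_of_val fun u ↦ by simp [hr]
      map_smul' := fun c v ↦ g.ext_of_val fun u ↦ by simp [hr]; ring }
  refine ⟨LinearMap.toContinuousLinearMap L, fun _ X Z hX hZ ↦ ?_⟩
  have e : B (X x) (Z x) = g.koszul Y X Z x := TensorialAt.mkHom₂_apply h₁ h₂ hX hZ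
  rw [← e]
  simp [L, hr]

/-- The Levi-Civita connection `∇^g`, defined by the Koszul formula. Mathlib's argument order is
`D Y x v` for `∇_v Y` at `x`. -/
def leviCivita : CovariantDerivative 𝓘(ℝ, E) E (TangentSpace 𝓘(ℝ, E) : M → Type _) where
  toFun Y x := (g.exists_koszul Y x).choose
  isCovariantDerivativeOnUniv :=
    { add := by
        intro Y Y' x hY hY' _
        have h := (g.exists_koszul Y x).choose_spec hY
        have h' := (g.exists_koszul Y' x).choose_spec hY'
        have h'' := (g.exists_koszul (Y + Y') x).choose_spec
          (mdifferentiableAt_add_section hY hY')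
        ext v
        refine g.ext_of_val fun w ↦ ?_
        have hv := FiberBundle.mdifferentiableAt_extend 𝓘(ℝ, E) E v
        have hw := FiberBundle.mdifferentiableAt_extend 𝓘(ℝ, E) E w
        have := koszul_add₁ (g := g) hY hY' hv hw
        rw [← h _ _ hv hw, ← h' _ _ hv hw, ← h'' _ _ hv hw] at this
        simp only [FiberBundle.extend_apply_self] at this
        simp
        linarith
      leibniz := by
        intro Y f x hY hf _
        have h := (g.exists_koszul Y x).choose_spec hY
        have h'' := (g.exists_koszul (f • Y) x).choose_spec (hf.smul_section hY)
        ext v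
        refine g.ext_of_val fun w ↦ ?_
        have hv := FiberBundle.mdifferentiableAt_extend 𝓘(ℝ, E) E v
        have hw := FiberBundle.mdifferentiableAt_extend 𝓘(ℝ, E) E w
        have := koszul_smul₁ (g := g) hf hY hv hw
        rw [← h _ _ hv hw, ← h'' _ _ hv hw] at this
        simp only [FiberBundle.extend_apply_self] at this
        simp
        linarith }

theorem leviCivita_koszul (hY : MDiffAt (T% Y) x) (hX : MDiffAt (T% X) x) (hZ : MDiffAt (T% Z) x) :
    2 * g.val x (g.leviCivita Y x (X x)) (Z x) = g.koszul Y X Z x :=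
  (g.exists_koszul Y x).choose_spec hY X Z hX hZ

/-- `D` is a metric connection, `D g = 0`: `v g(X, Y) = g(D_v X, Y) + g(X, D_v Y)`. -/
def IsMetric (D : CovariantDerivative 𝓘(ℝ, E) E (TangentSpace 𝓘(ℝ, E) : M → Type _)) : Prop :=
  ∀ (x : M) (X Y : Π x : M, TangentSpace 𝓘(ℝ, E) x), MDiffAt (T% X) x → MDiffAt (T% Y) x →
    ∀ v : TangentSpace 𝓘(ℝ, E) x,
      mvfderiv 𝓘(ℝ, E) (fun y ↦ g.val y (X y) (Y y)) x v
        = g.val x (D X x v) (Y x) + g.val x (X x) (D Y x v)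

/-- `∇^g` is metric. -/
theorem isMetric_leviCivita : g.IsMetric g.leviCivita := by
  intro x X Y hX hY v
  have hv := FiberBundle.mdifferentiableAt_extend 𝓘(ℝ, E) E v
  have h₁ := g.leviCivita_koszul hX hv hY
  have h₂ := g.leviCivita_koszul hY hv hX
  have hs : ∀ X Y : Π x : M, TangentSpace 𝓘(ℝ, E) x,
      (fun y ↦ g.val y (X y) (Y y)) = (fun y ↦ g.val y (Y y) (X y)) :=
    fun X Y ↦ funext fun y ↦ g.symm y _ _
  unfold koszul at h₁ h₂
  rw [VectorField.mlieBracket_swap_apply (V := X) (W := Y),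
    VectorField.mlieBracket_swap_apply (V := Y) (W := FiberBundle.extend E v)] at h₁
  rw [VectorField.mlieBracket_swap_apply (V := X) (W := FiberBundle.extend E v), hs Y X,
    hs X (FiberBundle.extend E v), hs (FiberBundle.extend E v) Y] at h₂
  simp only [FiberBundle.extend_apply_self, map_neg, _root_.neg_apply] at h₁ h₂
  rw [g.symm x (X x)]
  linarith

/-- `∇^g` is torsion-free. -/
theorem torsion_leviCivita : (g.leviCivita).torsion = 0 := by
  rw [CovariantDerivative.torsion_eq_zero_iff]
  intro X Y x hX hY
  refine g.ext_of_val fun w ↦ ?_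
  have hw := FiberBundle.mdifferentiableAt_extend 𝓘(ℝ, E) E w
  have h₁ := g.leviCivita_koszul hX hY hw
  have h₂ := g.leviCivita_koszul hY hX hw
  have hs : ∀ X Y : Π x : M, TangentSpace 𝓘(ℝ, E) x,
      (fun y ↦ g.val y (X y) (Y y)) = (fun y ↦ g.val y (Y y) (X y)) :=
    fun X Y ↦ funext fun y ↦ g.symm y _ _
  unfold koszul at h₁ h₂
  rw [VectorField.mlieBracket_swap_apply (V := Y) (W := X), hs X (FiberBundle.extend E w),
    hs (FiberBundle.extend E w) Y, hs Y X,
    VectorField.mlieBracket_swap_apply (V := FiberBundle.extend E w) (W := Y),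
    VectorField.mlieBracket_swap_apply (V := X) (W := FiberBundle.extend E w)] at h₁
  simp only [FiberBundle.extend_apply_self, map_neg, _root_.neg_apply] at h₁ h₂
  simp
  linarith

/-- The metric has signature `(-, +, …, +)` at every point: there is a vector `u` with
`g(u, u) < 0` on whose orthogonal complement `g` is positive definite. -/
def IsLorentzian : Prop :=
  ∀ x : M, ∃ u : TangentSpace 𝓘(ℝ, E) x, g.val x u u < 0 ∧
    ∀ w : TangentSpace 𝓘(ℝ, E) x, g.val x u w = 0 → w ≠ 0 → 0 < g.val x w w

/-- The bivector `X ∧ Y` as an endomorphism, `(X ∧ Y) Z = g(X, Z) Y - g(Y, Z) X`. -/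
def wedge {x : M} (X Y Z : TangentSpace 𝓘(ℝ, E) x) : TangentSpace 𝓘(ℝ, E) x :=
  g.val x X Z • Y - g.val x Y Z • X

/-- The smooth tensor field `S` is a 3-form: `S(X, Y, Z) = g(S(X, Y), Z)` is alternating. -/
structure IsThreeForm
    (S : Π x : M, TangentSpace 𝓘(ℝ, E) x →L[ℝ] TangentSpace 𝓘(ℝ, E) x →L[ℝ]
      TangentSpace 𝓘(ℝ, E) x) : Prop where
  alt_left (x : M) (X Z : TangentSpace 𝓘(ℝ, E) x) : g.val x (S x X X) Z = 0
  alt_right (x : M) (X Y : TangentSpace 𝓘(ℝ, E) x) : g.val x (S x X Y) Y = 0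
  contMDiff : ContMDiff 𝓘(ℝ, E) (𝓘(ℝ, E).prod 𝓘(ℝ, E →L[ℝ] E →L[ℝ] E)) ∞
    (fun x ↦ TotalSpace.mk' (E →L[ℝ] E →L[ℝ] E)
      (E := fun x : M ↦ TangentSpace 𝓘(ℝ, E) x →L[ℝ] TangentSpace 𝓘(ℝ, E) x →L[ℝ]
        TangentSpace 𝓘(ℝ, E) x) x (S x))

/-- The torsion `T` of `D` has vectorial component `ξ`, skew-symmetric component `S` and zero
twistorial component: `T(X, Y) = (X ∧ Y) ξ + S(X, Y)` with a smooth vector field `ξ` and a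
3-form `S`. -/
structure HasTwistorFreeTorsion
    (D : CovariantDerivative 𝓘(ℝ, E) E (TangentSpace 𝓘(ℝ, E) : M → Type _))
    (ξ : Π x : M, TangentSpace 𝓘(ℝ, E) x)
    (S : Π x : M, TangentSpace 𝓘(ℝ, E) x →L[ℝ] TangentSpace 𝓘(ℝ, E) x →L[ℝ]
      TangentSpace 𝓘(ℝ, E) x) : Prop where
  contMDiff_vectorial : ContMDiff 𝓘(ℝ, E) (𝓘(ℝ, E).prod 𝓘(ℝ, E)) ∞ (T% ξ)
  isThreeForm_skew : g.IsThreeForm S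
  torsion_eq (x : M) (X Y : TangentSpace 𝓘(ℝ, E) x) :
    D.torsion x X Y = g.wedge X Y (ξ x) + S x X Y

end PseudoRiemannianMetric

/-- The torsion `T` of `D` is parallel, `D T = 0`:
`D_v (T(X, Y)) = T(D_v X, Y) + T(X, D_v Y)`. -/
def HasParallelTorsion
    (D : CovariantDerivative 𝓘(ℝ, E) E (TangentSpace 𝓘(ℝ, E) : M → Type _)) : Prop :=
  ∀ (x : M) (X Y : Π x : M, TangentSpace 𝓘(ℝ, E) x), MDiffAt (T% X) x → MDiffAt (T% Y) x →
    ∀ v : TangentSpace 𝓘(ℝ, E) x,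
      D (fun y ↦ D.torsion y (X y) (Y y)) x v
        = D.torsion x (D X x v) (Y x) + D.torsion x (X x) (D Y x v)

/-- The velocity `γ'(t)` of a curve. -/
def velocity (γ : ℝ → M) (t : ℝ) : TangentSpace 𝓘(ℝ, E) (γ t) :=
  mfderiv 𝓘(ℝ, ℝ) 𝓘(ℝ, E) γ t (1 : ℝ)

/-- The covariant derivative `(D_t V)(t)` of a vector field `V` along the curve `γ`. In the
trivialization of `TM` by a chart at `γ t`, with coordinate frame `e_i` and `V = ∑ vⁱ e_i`, it is
`∑ (vⁱ)'(t) e_i + D_{γ'(t)} (∑ vⁱ(t) e_i)`. -/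
def covDerivAlong (D : CovariantDerivative 𝓘(ℝ, E) E (TangentSpace 𝓘(ℝ, E) : M → Type _))
    (γ : ℝ → M) (V : Π t : ℝ, TangentSpace 𝓘(ℝ, E) (γ t)) (t : ℝ) :
    TangentSpace 𝓘(ℝ, E) (γ t) :=
  letI e := trivializationAt E (TangentSpace 𝓘(ℝ, E) : M → Type _) (γ t)
  letI v : ℝ → E := fun s ↦ (e ⟨γ s, V s⟩).2
  e.symm (γ t) (deriv v t) + D (fun y ↦ e.symm y (v t)) (γ t) (velocity γ t)

namespace PseudoRiemannianMetric
variable (g : PseudoRiemannianMetric E M)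

/-- `γ : ℝ → M` is a (complete) geodesic of `g`: it is smooth and `∇^g_{γ'} γ' = 0`. -/
def IsGeodesic (γ : ℝ → M) : Prop :=
  ContMDiff 𝓘(ℝ, ℝ) 𝓘(ℝ, E) ∞ γ ∧
    ∀ t : ℝ, covDerivAlong g.leviCivita γ (velocity γ) t = 0

/-- Geodesic `η`-completeness for `η = 1` (space-like), `η = -1` (time-like) and `η = 0`
(light-like): for every point `p` and every nonzero `v ∈ T_pM` such that `g(v, v)` has sign `η`,
the geodesic with initial position `p` and initial velocity `v` is defined on all of `ℝ`. -/
def IsGeodesicallyComplete (η : SignType) : Prop :=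
  ∀ (p : M) (v : TangentSpace 𝓘(ℝ, E) p), v ≠ 0 → SignType.sign (g.val p v v) = η →
    ∃ γ : ℝ → M, g.IsGeodesic γ ∧
      (⟨γ 0, velocity γ 0⟩ : TangentBundle 𝓘(ℝ, E) M) = ⟨p, v⟩

end PseudoRiemannianMetric

end

/-! Pairing `T(X, Y)` with `Y` kills the 3-form and leaves an expression in `ξ` and `g` alone. Since
`T` and `g` are `D`-parallel, differentiating it forces `D ξ = 0` (`deriv_vectorial_eq_zero`).
Rewriting `D` through the Levi-Civita connection then shows that `g(ξ, ξ)` is constant along curves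
and that `g(∇^g_X ξ, X) = g(X, X) g(ξ, ξ) - g(X, ξ)²`.

Along a geodesic `γ`, the function `f = g(γ', ξ)` therefore satisfies `f' = c - f²` with the
constant `c = g(γ', γ') g(ξ, ξ)`. A solution with `f(0) ≤ 0` and `f(0)² > c` tends to `-∞` in finite
time (`le_sq_of_riccati`). The condition `f(0)² > c` says that `γ'(0)` and `ξ` span a Lorentzian
plane. Such a plane contains initial velocities of every causal character satisfying this condition
(`exists_sign_eq_and_lt_sq`), and the sign of `f(0)` is fixed by passing to `-v`. -/

/-! ### Lorentzian linear algebra and the scalar Riccati equation -/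

theorem exists_orthogonal_ne_zero {V : Type*} [AddCommGroup V] [Module ℝ V]
    (B : V →ₗ[ℝ] V →ₗ[ℝ] ℝ) (hV : 2 ≤ Module.finrank ℝ V) (u : V) : ∃ w, B u w = 0 ∧ w ≠ 0 := by
  have : FiniteDimensional ℝ V := Module.finite_of_finrank_pos (by lia)
  have hker : LinearMap.ker (B u) ≠ ⊥ := LinearMap.ker_ne_bot_of_finrank_lt
    (by rw [Module.finrank_self]; lia)
  obtain ⟨w, hw, hw0⟩ := Submodule.exists_mem_ne_zero_of_ne_bot hker
  exact ⟨w, hw, hw0⟩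

/-- A global solution of the Riccati equation `f' = c - f²` cannot start below its equilibria. -/
theorem le_sq_of_riccati {f : ℝ → ℝ} {c : ℝ} (hf : ∀ t, HasDerivAt f (c - f t ^ 2) t)
    (h0 : f 0 ≤ 0) : f 0 ^ 2 ≤ c := by
  by_contra! hc
  have hcont : Continuous f := continuous_iff_continuousAt.2 fun t ↦ (hf t).continuousAt
  have hF : ∀ t, HasDerivAt (fun u ↦ ∫ s in (0 : ℝ)..u, f s) (f t) t := fun t ↦
    hcont.integral_hasStrictDerivAt 0 t |>.hasDerivAt
  -- Integrating factor for `(f² - c)' = -2 f (f² - c)`: it keeps `f² - c` positive for all time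
  -- without a uniqueness theorem.
  have hconst : ∀ t, HasDerivAt (fun u ↦ (f u ^ 2 - c) * Real.exp (2 * ∫ s in (0 : ℝ)..u, f s))
      0 t := fun t ↦ by
    refine ((((hf t).pow 2).sub_const c).mul (((hF t).const_mul 2).exp)).congr_deriv ?_
    simp
    ring
  have hpos : ∀ t, 0 < f t ^ 2 - c := fun t ↦ by
    have := is_const_of_deriv_eq_zero (fun t ↦ (hconst t).differentiableAt)
      (fun t ↦ (hconst t).deriv) t 0
    simp only [intervalIntegral.integral_same, mul_zero, Real.exp_zero, mul_one] at this
    refine pos_of_mul_pos_left (this.symm ▸ sub_pos.2 hc) (Real.exp_pos _).le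
  have hanti : Antitone f := antitone_of_deriv_nonpos (fun t ↦ (hf t).differentiableAt) fun t ↦ by
    rw [(hf t).deriv]; linarith [hpos t]
  -- For `t ≥ 0` one has `f t ≤ f 0 ≤ 0`, so `f²` only grows and the slope of `f` stays at most `c -
  -- f(0)² < 0`.
  have hdecay : ∀ t, 0 ≤ t → f t ≤ f 0 - (f 0 ^ 2 - c) * t := fun t ht ↦ by
    have hd : ∀ t, HasDerivAt (fun t ↦ f t + (f 0 ^ 2 - c) * t) (f 0 ^ 2 - f t ^ 2) t := fun t ↦
      ((hf t).add ((hasDerivAt_id t).const_mul _)).congr_deriv (by simp)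
    have := antitoneOn_of_deriv_nonpos (convex_Ici 0)
      (fun t _ ↦ (hd t).continuousAt.continuousWithinAt)
      (fun t _ ↦ (hd t).differentiableAt.differentiableWithinAt) (fun t ht ↦ by
        rw [(hd t).deriv]
        simp only [interior_Ici, Set.mem_Ioi] at ht
        nlinarith [hanti ht.le]) Set.self_mem_Ici ht ht
    simp at this
    linarith
  -- The threshold is chosen so that `f² ≥ 2|c|` from time `T` on; hence `(1/f)' = 1 - c/f² ≥ 1/2`.
  obtain ⟨T, hT0, hT⟩ : ∃ T, 0 ≤ T ∧ f T ≤ -(1 + 2 * |c|) := by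
    have hp := sub_pos.2 hc
    refine ⟨(1 + 2 * |c|) / (f 0 ^ 2 - c), by positivity, (hdecay _ (by positivity)).trans ?_⟩
    rw [mul_div_cancel₀ _ hp.ne']
    linarith
  have hneg : ∀ t, T ≤ t → f t ≤ -(1 + 2 * |c|) := fun t ht ↦ (hanti ht).trans hT
  have habs := abs_nonneg c
  have hne : ∀ t, T ≤ t → f t ≠ 0 := fun t ht ↦ by linarith [hneg t ht] |> ne_of_lt
  have hd : ∀ t, T ≤ t → HasDerivAt (fun t ↦ (f t)⁻¹ - t / 2) (1 / 2 - c / f t ^ 2) t :=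
    fun t ht ↦ (((hf t).inv (hne t ht)).sub ((hasDerivAt_id t).div_const 2)).congr_deriv (by
      field_simp [hne t ht]; ring)
  have hmono := monotoneOn_of_deriv_nonneg (convex_Ici T)
    (fun t ht ↦ (hd t ht).continuousAt.continuousWithinAt)
    (fun t ht ↦ (hd t (interior_subset ht)).differentiableAt.differentiableWithinAt) (fun t ht ↦ by
      have ht := interior_subset ht
      rw [(hd t ht).deriv, sub_nonneg, div_le_div_iff₀ (by have := hne t ht; positivity) two_pos]
      nlinarith [hneg t ht, le_abs_self c])
  -- By this time `1/f`, growing at rate at least `1/2` from `1/f(T)`, would be nonnegative,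
  -- although `f` stays negative.
  set s := T - 2 * (f T)⁻¹
  have hfT : (f T)⁻¹ < 0 := inv_lt_zero.2 (by linarith)
  have hs : T ≤ s := by simp only [s]; linarith
  have := hmono Set.self_mem_Ici hs hs
  have hfs : (f s)⁻¹ < 0 := inv_lt_zero.2 (by linarith [hneg s hs])
  simp only [s] at this hfs
  linarith

/-- In a Lorentzian vector space of dimension at least two, every nonzero vector `ξ` spans a
Lorentzian plane together with some vector of any prescribed causal character. -/
theorem exists_sign_eq_and_lt_sq {V : Type*} [AddCommGroup V] [Module ℝ V] (B : V →ₗ[ℝ] V →ₗ[ℝ] ℝ)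
    (hB : ∀ v w, B v w = B w v) (hV : 2 ≤ Module.finrank ℝ V) {u : V} (hu : B u u < 0)
    (hpos : ∀ w, B u w = 0 → w ≠ 0 → 0 < B w w) {ξ : V} (hξ : ξ ≠ 0) (η : SignType) :
    ∃ v, SignType.sign (B v v) = η ∧ B v v * B ξ ξ < B v ξ ^ 2 := by
  -- Any causal character at first: `w = u` works unless `ξ` is a multiple of `u`, in which case `w`
  -- is taken orthogonal to `u`.
  obtain ⟨w, hw⟩ : ∃ w, B w w * B ξ ξ < B w ξ ^ 2 := by
    obtain ⟨a, ζ, hζ, rfl⟩ : ∃ (a : ℝ) (ζ : V), B u ζ = 0 ∧ ξ = a • u + ζ :=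
      ⟨B u ξ / B u u, ξ - (B u ξ / B u u) • u, by simp [hu.ne], by simp⟩
    by_cases h : ζ = 0
    · subst h
      obtain ⟨w, hw, hw0⟩ := exists_orthogonal_ne_zero B hV u
      refine ⟨w, ?_⟩
      have ha : a ≠ 0 := by rintro rfl; simp at hξ
      have := hpos w hw hw0
      simp [hB w u, hw]
      have : 0 < a ^ 2 := by positivity
      nlinarith [mul_pos this (mul_pos (neg_pos.2 hu) (hpos w hw hw0))]
    · refine ⟨u, ?_⟩
      simp [hB ζ u, hζ]
      nlinarith [mul_pos (neg_pos.2 hu) (hpos ζ hζ h)]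
  -- The Gram determinant of `w, ξ` is unchanged by `w ↦ w + β ξ`, so only the sign of the quadratic
  -- polynomial `B(w + βξ, w + βξ)` in `β` has to be adjusted.
  have key : ∀ β : ℝ, SignType.sign (B (w + β • ξ) (w + β • ξ)) = η →
      ∃ v, SignType.sign (B v v) = η ∧ B v v * B ξ ξ < B v ξ ^ 2 := fun β h ↦ ⟨_, h, by
    simp [hB ξ w]
    nlinarith⟩
  have hQ : ∀ β : ℝ, B (w + β • ξ) (w + β • ξ) = B w w + 2 * β * B w ξ + β ^ 2 * B ξ ξ := fun β ↦ by
    simp [hB ξ w]; ring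
  simp only [hQ] at key
  set p := B w w
  set q := B w ξ
  set r := B ξ ξ
  have hD : 0 < q ^ 2 - p * r := by linarith
  by_cases hr : r = 0
  · have hq : q ≠ 0 := by rintro h; simp [h, hr] at hD
    have e : ∀ z : ℝ, p + 2 * ((z - p) / (2 * q)) * q + ((z - p) / (2 * q)) ^ 2 * r = z := by
      intro z; rw [hr]; field_simp; ring
    cases η
    · exact key ((0 - p) / (2 * q)) (by rw [e]; simp)
    · exact key ((-1 - p) / (2 * q)) (by rw [e]; simp)
    · exact key ((1 - p) / (2 * q)) (by rw [e]; simp)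
  -- Completing the square with `d = q² - pr > 0`: the choices `z² = 0, d, 2d` give the values
  -- `-d/r, 0, d/r`, which cover all signs.
  · have e : ∀ z : ℝ, p + 2 * ((z - q) / r) * q + ((z - q) / r) ^ 2 * r
        = (z ^ 2 - (q ^ 2 - p * r)) / r := by
      intro z; field_simp; ring
    have e₀ := e 0
    have e₁ := e √(q ^ 2 - p * r)
    have e₂ := e √(2 * (q ^ 2 - p * r))
    rw [Real.sq_sqrt hD.le, sub_self, zero_div] at e₁
    rw [Real.sq_sqrt (by linarith)] at e₂
    cases η
    · exact key _ (by rw [e₁]; simp)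
    · rcases lt_or_gt_of_ne hr with hr | hr
      · exact key _ (by rw [e₂]; exact sign_neg (div_neg_of_pos_of_neg (by linarith) hr))
      · exact key _ (by rw [e₀]; exact sign_neg (div_neg_of_neg_of_pos (by linarith) hr))
    · rcases lt_or_gt_of_ne hr with hr | hr
      · exact key _ (by rw [e₀]; exact sign_pos (div_pos_of_neg_of_neg (by linarith) hr))
      · exact key _ (by rw [e₂]; exact sign_pos (div_pos (by linarith) hr))

/-! ### Parallel torsion and its vectorial component -/

section
set_option linter.unusedSectionVars false
variable {E : Type*} [NormedAddCommGroup E] [NormedSpace ℝ E] [FiniteDimensional ℝ E]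
  {M : Type*} [TopologicalSpace M] [ChartedSpace E M] [IsManifold 𝓘(ℝ, E) ∞ M]

namespace PseudoRiemannianMetric
variable {g : PseudoRiemannianMetric E M}
  {D : CovariantDerivative 𝓘(ℝ, E) E (TangentSpace 𝓘(ℝ, E) : M → Type _)}
  {ξ : Π x : M, TangentSpace 𝓘(ℝ, E) x}
  {S : Π x : M, TangentSpace 𝓘(ℝ, E) x →L[ℝ] TangentSpace 𝓘(ℝ, E) x →L[ℝ]
    TangentSpace 𝓘(ℝ, E) x}

theorem HasTwistorFreeTorsion.mdiffAt_vectorial (hT : g.HasTwistorFreeTorsion D ξ S) (x : M) :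
    MDiffAt (T% ξ) x :=
  hT.contMDiff_vectorial.mdifferentiableAt (by simp)

theorem IsThreeForm.mdiffAt (hS : g.IsThreeForm S) {x : M}
    {X Y : Π x : M, TangentSpace 𝓘(ℝ, E) x} (hX : MDiffAt (T% X) x) (hY : MDiffAt (T% Y) x) :
    MDiffAt (T% fun y ↦ S y (X y) (Y y)) x :=
  MDifferentiableAt.clm_bundle_apply₂ (F₁ := E) (F₂ := E)
    (hS.contMDiff.mdifferentiableAt (by simp)) hX hY

theorem IsThreeForm.alt_right_polarized (hS : g.IsThreeForm S) (x : M)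
    (X Y Z : TangentSpace 𝓘(ℝ, E) x) : g.val x (S x X Y) Z + g.val x (S x X Z) Y = 0 := by
  have := hS.alt_right x X (Y + Z)
  simp only [map_add, _root_.add_apply, hS.alt_right] at this
  linarith

theorem HasTwistorFreeTorsion.mdiffAt_torsion (hT : g.HasTwistorFreeTorsion D ξ S) {x : M}
    {X Y : Π x : M, TangentSpace 𝓘(ℝ, E) x} (hX : MDiffAt (T% X) x) (hY : MDiffAt (T% Y) x) :
    MDiffAt (T% fun y ↦ D.torsion y (X y) (Y y)) x := by
  have hξ := hT.mdiffAt_vectorial x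
  have := mdifferentiableAt_add_section (mdifferentiableAt_sub_section
    ((g.mdiffAt hX hξ).smul_section hY) ((g.mdiffAt hY hξ).smul_section hX))
    (hT.isThreeForm_skew.mdiffAt hX hY)
  refine this.congr_of_eventuallyEq (.of_forall fun y ↦ ?_)
  simp [hT.torsion_eq, wedge]

/-- The 3-form vanishes on a repeated argument, so this contraction isolates `ξ`. -/
theorem HasTwistorFreeTorsion.torsion_apply_right (hT : g.HasTwistorFreeTorsion D ξ S) (x : M)
    (X Y : TangentSpace 𝓘(ℝ, E) x) : g.val x (D.torsion x X Y) Y =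
      g.val x X (ξ x) * g.val x Y Y - g.val x Y (ξ x) * g.val x X Y := by
  simp [hT.torsion_eq, wedge, hT.isThreeForm_skew.alt_right]

/-- If the torsion is parallel, its vectorial component satisfies
`g(X, ∇_v ξ) g(Y, Y) = g(Y, ∇_v ξ) g(X, Y)`. -/
theorem HasTwistorFreeTorsion.deriv_vectorial_mul (hT : g.HasTwistorFreeTorsion D ξ S)
    (hD : g.IsMetric D) (hpar : HasParallelTorsion D) (x : M) (v X Y : TangentSpace 𝓘(ℝ, E) x) :
    g.val x X (D ξ x v) * g.val x Y Y = g.val x Y (D ξ x v) * g.val x X Y := by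
  set X' := FiberBundle.extend E X
  set Y' := FiberBundle.extend E Y
  have hX : MDiffAt (T% X') x := FiberBundle.mdifferentiableAt_extend 𝓘(ℝ, E) E X
  have hY : MDiffAt (T% Y') x := FiberBundle.mdifferentiableAt_extend 𝓘(ℝ, E) E Y
  have hξ := hT.mdiffAt_vectorial x
  have eX : X' x = X := by simp [X']
  have eY : Y' x = Y := by simp [Y']
  have h₁ := hD x _ _ (hT.mdiffAt_torsion hX hY) hY v
  rw [hpar x X' Y' hX hY v] at h₁
  -- The same contraction is differentiated in two ways: through the parallel torsion, and as a
  -- polynomial in `g` and `ξ`. Only the terms with `D ξ` survive the comparison.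
  have e : (fun y ↦ g.val y (D.torsion y (X' y) (Y' y)) (Y' y)) =
      (fun y ↦ g.val y (X' y) (ξ y)) * (fun y ↦ g.val y (Y' y) (Y' y))
        - (fun y ↦ g.val y (Y' y) (ξ y)) * (fun y ↦ g.val y (X' y) (Y' y)) :=
    funext fun y ↦ hT.torsion_apply_right y _ _
  rw [e, mvfderiv_sub ((g.mdiffAt hX hξ).mul (g.mdiffAt hY hY))
    ((g.mdiffAt hY hξ).mul (g.mdiffAt hX hY)), mvfderiv_mul (g.mdiffAt hX hξ) (g.mdiffAt hY hY),
    mvfderiv_mul (g.mdiffAt hY hξ) (g.mdiffAt hX hY)] at h₁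
  simp only [_root_.sub_apply, _root_.add_apply, _root_.smul_apply, smul_eq_mul, hD x _ _ hX hξ,
    hD x _ _ hY hY, hD x _ _ hY hξ, hD x _ _ hX hY, map_add, eX, eY] at h₁
  -- Cancels the two 3-form terms in which `Y'` has been differentiated.
  have h₂ := hT.isThreeForm_skew.alt_right_polarized x X Y (D Y' x v)
  simp only [hT.torsion_eq, wedge, map_add, map_sub, map_smul, _root_.add_apply, _root_.sub_apply,
    _root_.smul_apply, smul_eq_mul, hT.isThreeForm_skew.alt_right] at h₁
  have s := g.symm x
  rw [s (D Y' x v) Y] at h₁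
  linarith

/-- The vectorial component of a parallel twistor-free torsion is parallel. -/
theorem HasTwistorFreeTorsion.deriv_vectorial_eq_zero (hdim : 2 ≤ Module.finrank ℝ E)
    (hg : g.IsLorentzian) (hT : g.HasTwistorFreeTorsion D ξ S)
    (hD : g.IsMetric D) (hpar : HasParallelTorsion D) (x : M) (v : TangentSpace 𝓘(ℝ, E) x) :
    D ξ x v = 0 := by
  have h := hT.deriv_vectorial_mul hD hpar x v
  obtain ⟨u, hu, hpos⟩ := hg x
  obtain ⟨w, hw, hw0⟩ := exists_orthogonal_ne_zero (V := TangentSpace 𝓘(ℝ, E) x)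
    (g.val x).toLinearMap₁₂ hdim u
  have hw : g.val x u w = 0 := hw
  -- Taking `Y = w ⊥ u` shows that `D_v ξ` is orthogonal to `u`; then `Y = u` shows that it is
  -- orthogonal to everything.
  have hu0 : g.val x u (D ξ x v) = 0 := by
    have := h u w
    rw [hw, mul_zero] at this
    exact (mul_eq_zero.1 this).resolve_right (hpos w hw hw0).ne'
  refine g.nondegenerate x _ fun z ↦ ?_
  have := h z u
  rw [hu0, zero_mul, g.symm] at this
  exact (mul_eq_zero.1 this).resolve_right hu.ne

/-- The Levi-Civita connection in terms of a metric connection and its torsion. -/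
theorem IsMetric.two_mul_leviCivita (hD : g.IsMetric D) {x : M}
    {Y : Π x : M, TangentSpace 𝓘(ℝ, E) x} (hY : MDiffAt (T% Y) x)
    (X Z : TangentSpace 𝓘(ℝ, E) x) :
    2 * g.val x (g.leviCivita Y x X) Z = 2 * g.val x (D Y x X) Z
      - g.val x (D.torsion x X (Y x)) Z + g.val x (D.torsion x (Y x) Z) X
      - g.val x (D.torsion x Z X) (Y x) := by
  set X' := FiberBundle.extend E X
  set Z' := FiberBundle.extend E Z
  have hX : MDiffAt (T% X') x := FiberBundle.mdifferentiableAt_extend 𝓘(ℝ, E) E X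
  have hZ : MDiffAt (T% Z') x := FiberBundle.mdifferentiableAt_extend 𝓘(ℝ, E) E Z
  have eX : X' x = X := by simp [X']
  have eZ : Z' x = Z := by simp [Z']
  have h := g.leviCivita_koszul hY hX hZ
  have h₁ := D.torsion_apply hX hY
  have h₂ := D.torsion_apply hY hZ
  have h₃ := D.torsion_apply hZ hX
  rw [eX] at h₁ h₃
  rw [eZ] at h₂ h₃
  -- In the Koszul formula, metricity turns derivatives of `g` into `D`-terms, and each bracket is a
  -- difference of `D`-terms minus torsion.
  rw [koszul, hD x _ _ hY hZ, hD x _ _ hZ hX, hD x _ _ hX hY, eX, eZ] at h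
  rw [h, h₁, h₂, h₃]
  simp only [map_sub, _root_.sub_apply]
  have s := g.symm x
  rw [s (Y x) (D Z' x X), s Z (D X' x (Y x)), s X (D Y x Z)]
  ring

/-- `g(∇^g_X ξ, X) = g(X, X) g(ξ, ξ) - g(X, ξ)²`; along geodesics this is a Riccati equation for
`g(γ', ξ)`. -/
theorem HasTwistorFreeTorsion.leviCivita_vectorial (hdim : 2 ≤ Module.finrank ℝ E)
    (hg : g.IsLorentzian) (hT : g.HasTwistorFreeTorsion D ξ S)
    (hD : g.IsMetric D) (hpar : HasParallelTorsion D) (x : M) (X : TangentSpace 𝓘(ℝ, E) x) :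
    g.val x (g.leviCivita ξ x X) X
      = g.val x X X * g.val x (ξ x) (ξ x) - g.val x X (ξ x) ^ 2 := by
  have h := hD.two_mul_leviCivita (hT.mdiffAt_vectorial x) X X
  have := hT.torsion_apply_right x (ξ x) X
  rw [hT.deriv_vectorial_eq_zero hdim hg hD hpar, D.torsion_antisymm X (ξ x),
    D.torsion_self] at h
  simp only [map_neg, _root_.neg_apply, map_zero, _root_.zero_apply] at h
  rw [g.symm x (ξ x) X] at this
  linarith

/-- With `D ξ = 0`, the remaining torsion terms cancel by antisymmetry. It makes `g(ξ, ξ)` constant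
along curves. -/
theorem HasTwistorFreeTorsion.leviCivita_vectorial_self (hdim : 2 ≤ Module.finrank ℝ E)
    (hg : g.IsLorentzian) (hT : g.HasTwistorFreeTorsion D ξ S)
    (hD : g.IsMetric D) (hpar : HasParallelTorsion D) (x : M) (X : TangentSpace 𝓘(ℝ, E) x) :
    g.val x (g.leviCivita ξ x X) (ξ x) = 0 := by
  have h := hD.two_mul_leviCivita (hT.mdiffAt_vectorial x) X (ξ x)
  rw [hT.deriv_vectorial_eq_zero hdim hg hD hpar, D.torsion_antisymm X (ξ x),
    D.torsion_self] at h
  simp only [map_neg, _root_.neg_apply, map_zero, _root_.zero_apply] at h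
  linarith

end PseudoRiemannianMetric

/-! ### Product rules along curves -/

section Curve
open Filter Topology

variable {γ : ℝ → M} {V : Π t : ℝ, TangentSpace 𝓘(ℝ, E) (γ t)} {t : ℝ}

/-- The coordinate representation at time `t` of a vector field along a curve. -/
noncomputable def coordAlong (γ : ℝ → M) (V : Π t : ℝ, TangentSpace 𝓘(ℝ, E) (γ t)) (t s : ℝ) : E :=
  (trivializationAt E (TangentSpace 𝓘(ℝ, E) : M → Type _) (γ t) ⟨γ s, V s⟩).2

/-- The vector field with constant coordinates `w` near `x`. -/
noncomputable def coordExtend (x : M) (w : E) (y : M) : TangentSpace 𝓘(ℝ, E) y :=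
  (trivializationAt E (TangentSpace 𝓘(ℝ, E) : M → Type _) x).symmL ℝ y w

theorem baseSet_mem_nhds (x : M) :
    (trivializationAt E (TangentSpace 𝓘(ℝ, E) : M → Type _) x).baseSet ∈ 𝓝 x :=
  (trivializationAt E _ x).open_baseSet.mem_nhds (FiberBundle.mem_baseSet_trivializationAt' x)

theorem coordExtend_eq_symm {x y : M} (w : E)
    (hy : y ∈ (trivializationAt E (TangentSpace 𝓘(ℝ, E) : M → Type _) x).baseSet) :
    coordExtend x w y = (trivializationAt E (TangentSpace 𝓘(ℝ, E) : M → Type _) x).symm y w :=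
  Trivialization.symmL_apply (R := ℝ) _ hy w

theorem mdiffAt_coordExtend (x : M) (w : E) : MDiffAt (T% (coordExtend x w)) x := by
  rw [mdifferentiableAt_section]
  refine (mdifferentiableAt_const (c := w)).congr_of_eventuallyEq ?_
  filter_upwards [baseSet_mem_nhds (E := E) x] with y hy
  rw [coordExtend_eq_symm w hy, Trivialization.apply_mk_symm _ hy]

/-- Connections are local operators, so the coordinate extension may be replaced by `coordExtend`,
which is continuous linear in `w` over every point. -/
theorem covDerivAlong_eq (D : CovariantDerivative 𝓘(ℝ, E) E (TangentSpace 𝓘(ℝ, E) : M → Type _)) :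
    covDerivAlong D γ V t = coordExtend (γ t) (deriv (coordAlong γ V t) t) (γ t)
      + D (coordExtend (γ t) (coordAlong γ V t t)) (γ t) (velocity γ t) := by
  have he := coordExtend_eq_symm (E := E) (deriv (coordAlong γ V t) t)
    (mem_of_mem_nhds (baseSet_mem_nhds (E := E) (γ t)))
  have hcongr : ∀ᶠ y in 𝓝 (γ t), coordExtend (γ t) (coordAlong γ V t t) y =
      (trivializationAt E (TangentSpace 𝓘(ℝ, E) : M → Type _) (γ t)).symm y
        (coordAlong γ V t t) := by
    filter_upwards [baseSet_mem_nhds (E := E) (γ t)] with y hy using coordExtend_eq_symm _ hy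
  have hd := mdiffAt_coordExtend (γ t) (coordAlong γ V t t)
  have hd' : MDiffAt (T% fun y ↦ (trivializationAt E (TangentSpace 𝓘(ℝ, E) : M → Type _)
      (γ t)).symm y (coordAlong γ V t t)) (γ t) :=
    hd.congr_of_eventuallyEq (hcongr.mono fun y hy ↦ congrArg (TotalSpace.mk' E y) hy.symm)
  rw [he, D.isCovariantDerivativeOnUniv.congr_of_eventuallyEq hd hd' univ_mem hcongr]
  rfl

theorem eventually_coordExtend_coordAlong (hγ : ContinuousAt γ t) :
    ∀ᶠ s in 𝓝 t, coordExtend (γ t) (coordAlong γ V t s) (γ s) = V s := by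
  filter_upwards [hγ (baseSet_mem_nhds (E := E) (γ t))] with s hs
  rw [coordExtend_eq_symm _ hs]
  exact Trivialization.symm_apply_apply_mk _ hs (V s)

theorem coordExtend_coordAlong_self (hγ : ContinuousAt γ t) :
    coordExtend (γ t) (coordAlong γ V t t) (γ t) = V t :=
  (eventually_coordExtend_coordAlong hγ).self_of_nhds

/-- Product rule for a covector field `Φ` along `γ` applied to a vector field `V` along `γ`. -/
theorem hasDerivAt_covector_apply (hγ : ContinuousAt γ t)
    (hV : DifferentiableAt ℝ (coordAlong γ V t) t)
    {Φ : Π s : ℝ, TangentSpace 𝓘(ℝ, E) (γ s) →L[ℝ] ℝ} {k : E → ℝ}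
    (hΦ : ∀ w, HasDerivAt (fun s ↦ Φ s (coordExtend (γ t) w (γ s))) (k w) t) :
    HasDerivAt (fun s ↦ Φ s (V s))
      (Φ t (coordExtend (γ t) (deriv (coordAlong γ V t) t) (γ t)) + k (coordAlong γ V t t)) t := by
  let b := Module.finBasis ℝ E
  let v := coordAlong γ V t
  let L : ℝ → E →L[ℝ] ℝ := fun s ↦ Φ s ∘L
    (trivializationAt E (TangentSpace 𝓘(ℝ, E) : M → Type _) (γ t)).symmL ℝ (γ s)
  have hL : ∀ s w, L s w = Φ s (coordExtend (γ t) w (γ s)) := fun _ _ ↦ rfl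
  have hexp : ∀ (A : E →L[ℝ] ℝ) (w : E), A w = ∑ i, b.equivFunL w i * A (b i) := fun A w ↦ by
    conv_lhs => rw [← b.sum_equivFun w, map_sum]
    simp
  have hc : ∀ i, HasDerivAt (fun s ↦ b.equivFunL (v s - v t) i) (b.equivFunL (deriv v t) i) t :=
    fun i ↦ hasDerivAt_pi.1
      (b.equivFunL.toContinuousLinearMap.hasFDerivAt.comp_hasDerivAt t
        (hV.hasDerivAt.sub_const (v t))) i
  -- Write `v(s) = (v(s) - v(t)) + v(t)` and expand only the difference in the basis. Its
  -- coefficients vanish at `t`, so the values `k (b i)` drop out and no linearity of `k` is needed.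
  have hsum := (HasDerivAt.fun_sum (u := Finset.univ) fun i _ ↦ (hc i).mul (hΦ (b i))).add
    (hΦ (v t))
  refine (hsum.congr_of_eventuallyEq ?_).congr_deriv ?_
  · filter_upwards [eventually_coordExtend_coordAlong (V := V) hγ] with s hs
    simp only [Pi.add_apply, Pi.mul_apply, ← hL]
    rw [← hexp, map_sub, sub_add_cancel, hL, hs]
  · simp only [sub_self, map_zero, Pi.zero_apply, zero_mul, add_zero, ← hL]
    rw [← hexp]

namespace PseudoRiemannianMetric
variable {g : PseudoRiemannianMetric E M}
  {D : CovariantDerivative 𝓘(ℝ, E) E (TangentSpace 𝓘(ℝ, E) : M → Type _)}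
  {X Y : Π x : M, TangentSpace 𝓘(ℝ, E) x}

theorem IsMetric.hasDerivAt_val (hD : g.IsMetric D) (hγ : MDiffAt γ t)
    (hX : MDiffAt (T% X) (γ t)) (hY : MDiffAt (T% Y) (γ t)) :
    HasDerivAt (fun s ↦ g.val (γ s) (X (γ s)) (Y (γ s)))
      (g.val (γ t) (D X (γ t) (velocity γ t)) (Y (γ t))
        + g.val (γ t) (X (γ t)) (D Y (γ t) (velocity γ t))) t := by
  have hf := g.mdiffAt hX hY
  have h := (hf.comp t hγ).differentiableAt.hasDerivAt
  refine h.congr_deriv ?_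
  rw [← hD _ _ _ hX hY, ← fderiv_apply_one_eq_deriv, ← mfderiv_eq_fderiv]
  exact mvfderiv_comp_apply t hf hγ 1

theorem IsMetric.hasDerivAt_val_along_left (hD : g.IsMetric D) (hγ : MDiffAt γ t)
    (hV : DifferentiableAt ℝ (coordAlong γ V t) t) (hY : MDiffAt (T% Y) (γ t)) :
    HasDerivAt (fun s ↦ g.val (γ s) (V s) (Y (γ s)))
      (g.val (γ t) (covDerivAlong D γ V t) (Y (γ t))
        + g.val (γ t) (V t) (D Y (γ t) (velocity γ t))) t := by
  have h := hasDerivAt_covector_apply hγ.continuousAt hV (Φ := fun s ↦ g.val (γ s) (Y (γ s)))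
    fun w ↦ hD.hasDerivAt_val hγ hY (mdiffAt_coordExtend (γ t) w)
  simp only [coordExtend_coordAlong_self hγ.continuousAt] at h
  simp only [covDerivAlong_eq, map_add, _root_.add_apply, g.symm _ _ (Y _),
    g.symm _ (V t) (D Y _ _)]
  exact h.congr_deriv (by ring)

/-- The covector product rule is applied to `Φ = g(V, ·)`, whose values on coordinate fields are
differentiated by the mixed rule; each slot contributes half. -/
theorem IsMetric.hasDerivAt_val_along_self (hD : g.IsMetric D) (hγ : MDiffAt γ t)
    (hV : DifferentiableAt ℝ (coordAlong γ V t) t) :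
    HasDerivAt (fun s ↦ g.val (γ s) (V s) (V s))
      (2 * g.val (γ t) (covDerivAlong D γ V t) (V t)) t := by
  have h := hasDerivAt_covector_apply hγ.continuousAt hV (Φ := fun s ↦ g.val (γ s) (V s))
    fun w ↦ hD.hasDerivAt_val_along_left hγ hV (mdiffAt_coordExtend (γ t) w)
  simp only [coordExtend_coordAlong_self hγ.continuousAt] at h
  refine h.congr_deriv ?_
  rw [two_mul]
  conv_rhs => enter [2]; rw [g.symm, covDerivAlong_eq, map_add]
  ring

end PseudoRiemannianMetric

/-- The velocity is the tangent map of `γ` composed with the smooth section `s ↦ (s, 1)`. -/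
theorem differentiableAt_coordAlong_velocity {γ : ℝ → M} (hγ : ContMDiff 𝓘(ℝ, ℝ) 𝓘(ℝ, E) ∞ γ)
    (t : ℝ) :
    DifferentiableAt ℝ (coordAlong (E := E) γ (velocity γ) t) t := by
  have h₁ : ContMDiff 𝓘(ℝ, ℝ) 𝓘(ℝ, ℝ).tangent 1
      (fun s : ℝ ↦ (⟨s, (1 : ℝ)⟩ : TangentBundle 𝓘(ℝ, ℝ) ℝ)) :=
    contMDiff_vectorSpace_iff_contDiff.2 contDiff_const
  have h₂ := ((hγ.contMDiff_tangentMap (m := 1) (by norm_cast)).comp h₁).mdifferentiable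
    one_ne_zero t
  exact ((mdifferentiableAt_totalSpace _ _).1 h₂).2.differentiableAt

end Curve

end

/-! ### Incompleteness -/

theorem mainTheorem2 {E : Type*} [NormedAddCommGroup E] [NormedSpace ℝ E] [FiniteDimensional ℝ E]
    {M : Type*} [TopologicalSpace M] [ChartedSpace E M] [IsManifold 𝓘(ℝ, E) ∞ M]
    (hdim : 2 ≤ Module.finrank ℝ E)
    (g : PseudoRiemannianMetric E M) (hg : g.IsLorentzian)
    (D : CovariantDerivative 𝓘(ℝ, E) E (TangentSpace 𝓘(ℝ, E) : M → Type _))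
    (hD : g.IsMetric D) (hpar : HasParallelTorsion D)
    (ξ : Π x : M, TangentSpace 𝓘(ℝ, E) x)
    (S : Π x : M, TangentSpace 𝓘(ℝ, E) x →L[ℝ] TangentSpace 𝓘(ℝ, E) x →L[ℝ]
      TangentSpace 𝓘(ℝ, E) x)
    (hT : g.HasTwistorFreeTorsion D ξ S) (hξ : ∃ x : M, ξ x ≠ 0) :
    ¬ g.IsGeodesicallyComplete 1 ∧ ¬ g.IsGeodesicallyComplete (-1) ∧
      ¬ g.IsGeodesicallyComplete 0 := by
  suffices h : ∀ η, ¬ g.IsGeodesicallyComplete η from ⟨h _, h _, h _⟩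
  intro η hη
  obtain ⟨p, hp⟩ := hξ
  obtain ⟨v, hv, hlt, hle⟩ : ∃ v : TangentSpace 𝓘(ℝ, E) p, SignType.sign (g.val p v v) = η ∧
      g.val p v v * g.val p (ξ p) (ξ p) < g.val p v (ξ p) ^ 2 ∧ g.val p v (ξ p) ≤ 0 := by
    obtain ⟨u, hu, hpos⟩ := hg p
    obtain ⟨v, hv, hlt⟩ := exists_sign_eq_and_lt_sq (V := TangentSpace 𝓘(ℝ, E) p)
      (g.val p).toLinearMap₁₂ (g.symm p) hdim hu hpos hp η
    -- Replacing `v` by `-v` changes only the sign of `g(v, ξ)`.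
    rcases le_total (g.val p v (ξ p)) 0 with h | h
    · exact ⟨v, hv, hlt, h⟩
    · exact ⟨-v, by simpa using hv, by simpa using hlt, by simpa using h⟩
  -- The strict inequality excludes `v = 0`, also in the light-like case.
  obtain ⟨γ, ⟨hγ, hgeo⟩, hinit⟩ := hη p v (by rintro rfl; simp at hlt) hv
  have hvel := differentiableAt_coordAlong_velocity hγ
  have hγd : ∀ t, MDiffAt γ t := fun t ↦ hγ.mdifferentiable (by simp) t
  have hLC := g.isMetric_leviCivita
  have hξd := hT.mdiffAt_vectorial
  have hspeed := fun t ↦ hLC.hasDerivAt_val_along_self (hγd t) (hvel t)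
  have hnorm := fun t ↦ hLC.hasDerivAt_val (hγd t) (hξd (γ t)) (hξd (γ t))
  have hmom := fun t ↦ hLC.hasDerivAt_val_along_left (hγd t) (hvel t) (hξd (γ t))
  have hself := fun t ↦ hT.leviCivita_vectorial_self hdim hg hD hpar (γ t) (velocity γ t)
  simp only [hgeo, map_zero, _root_.zero_apply, mul_zero] at hspeed
  simp only [g.symm _ (ξ _) (g.leviCivita _ _ _), hself, add_zero] at hnorm
  have hmom' : ∀ t, HasDerivAt (fun s ↦ g.val (γ s) (velocity γ s) (ξ (γ s)))
      (g.val p v v * g.val p (ξ p) (ξ p) - g.val (γ t) (velocity γ t) (ξ (γ t)) ^ 2) t := by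
    intro t
    have e₁ := is_const_of_deriv_eq_zero (fun t ↦ (hspeed t).differentiableAt)
      (fun t ↦ (hspeed t).deriv) t 0
    have e₂ := is_const_of_deriv_eq_zero (fun t ↦ (hnorm t).differentiableAt)
      (fun t ↦ (hnorm t).deriv) t 0
    -- The fibres over `γ 0` and `p` are different types, so the initial condition is transported
    -- through scalar functions on the total space.
    have i₁ := congrArg (fun z : TangentBundle 𝓘(ℝ, E) M ↦ g.val z.1 z.2 z.2) hinit
    have i₂ := congrArg (fun z : TangentBundle 𝓘(ℝ, E) M ↦ g.val z.1 (ξ z.1) (ξ z.1)) hinit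
    refine (hmom t).congr_deriv ?_
    rw [hgeo, map_zero, _root_.zero_apply, zero_add, g.symm,
      hT.leviCivita_vectorial hdim hg hD hpar, e₁, e₂]
    exact congrArg₂ (fun a b ↦ a * b - _) i₁ i₂
  have i₃ := congrArg (fun z : TangentBundle 𝓘(ℝ, E) M ↦ g.val z.1 z.2 (ξ z.1)) hinit
  simp only at i₃
  have := le_sq_of_riccati hmom' (i₃ ▸ hle)
  rw [i₃] at this
  exact absurd hlt this.not_gt
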